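/- Identify $M_k\otimes M_k$ (with $M_k=M_k(\mathbb{C})$) with $M_{k^2}$ via the Kronecker product, and equip $M_k$ with the inner product $\langle C,D\rangle=\operatorname{tr}(CD^*)$. A \emph{Hermitian Schmidt decomposition} of $A\in M_k\otimes M_k$ is an expression $A=\sum_{i=1}^n\lambda_i\,\gamma_i\otimes\delta_i$ in which $\lambda_i>0$ are real numbers and $\gamma_1,\dots,\gamma_n\in M_k$ and $\delta_1,\dots,\delta_n\in M_k$ are two orthonormal families of Hermitian matrices (for $A=0$ the empty sum, $n=0$, is allowed). A positive semidefinite Hermitian matrix $A\in M_k\otimes M_k$ is called \emph{SPC} (symmetric with positive coefficients) if it has a Hermitian Schmidt decomposition of the form $A=\sum_{i=1}^n\lambda_i\,\gamma_i\otimes\gamma_i$. \textbf{Theorem (Split decomposition for SPC matrices).} Let $A\in M_k\otimes M_k$ be an SPC matrix, and let $A=\sum_{i=1}^n\lambda_i\,\gamma_i\otimes\gamma_i$ be a Hermitian Schmidt decomposition of $A$ such that, for some $1\le s\le n$, $\lambda_1=\dots=\lambda_s>\lambda_{s+1}\ge\dots\ge\lambda_n>0$ (if $s=n$ this means $\lambda_1=\dots=\lambda_n>0$).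 Let $D=\sum_{i=1}^s\gamma_i\otimes\gamma_i$. a) There exists a Hermitian Schmidt decomposition $D=\sum_{i=1}^s\gamma_i'\otimes\gamma_i'$ such that every $\gamma_i'$ is positive semidefinite, and it is unique up to the order of the terms. b) Let $\gamma_1',\dots,\gamma_s'$ be as in a). Then the sum $\Im(\gamma_1')+\dots+\Im(\gamma_s')\subset\mathbb{C}^k$ of the images is direct. Let $V_i\in M_k$ be the Hermitian (orthogonal) projection onto $\Im(\gamma_i')$ for $1\le i\le s$, and let $V_{s+1}\in M_k$ be the Hermitian projection onto $(\Im(\gamma_1')\oplus\dots\oplus\Im(\gamma_s'))^{\perp}$. Then $$A=\sum_{i=1}^{s+1}(V_i\otimes V_i)\,A\,(V_i\otimes V_i),$$ and each matrix $(V_i\otimes V_i)\,A\,(V_i\otimes V_i)$, $1\le i\le s+1$, is again SPC. -/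

import Mathlib

open scoped ComplexOrder Kronecker

noncomputable section

namespace SplitDecomposition

/-- A finite family of matrices is orthonormal for the inner product `⟨C, D⟩ = tr (C D*)`. -/
def TraceOrthonormal {k n : ℕ} (γ : Fin n → Matrix (Fin k) (Fin k) ℂ) : Prop :=
  ∀ i j, Matrix.trace (γ i * (γ j).conjTranspose) = if i = j then 1 else 0

/-- `A = ∑ i, lam i • γ i ⊗ δ i` is a Schmidt decomposition of `A ∈ M_k ⊗ M_m`, where `M_k ⊗ M_m`
is identified with `M_{km}` through the Kronecker product. The empty decomposition (of `A = 0`)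
is allowed. -/
structure IsSchmidtDecomposition {k m n : ℕ}
    (A : Matrix (Fin k × Fin m) (Fin k × Fin m) ℂ) (lam : Fin n → ℝ)
    (γ : Fin n → Matrix (Fin k) (Fin k) ℂ) (δ : Fin n → Matrix (Fin m) (Fin m) ℂ) : Prop where
  pos : ∀ i, 0 < lam i
  orthonormal_left : TraceOrthonormal γ
  orthonormal_right : TraceOrthonormal δ
  eq_sum : A = ∑ i, (lam i : ℂ) • (γ i ⊗ₖ δ i)

/-- A Schmidt decomposition all of whose matrices are Hermitian. -/
structure IsHermitianSchmidtDecomposition {k m n : ℕ}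
    (A : Matrix (Fin k × Fin m) (Fin k × Fin m) ℂ) (lam : Fin n → ℝ)
    (γ : Fin n → Matrix (Fin k) (Fin k) ℂ) (δ : Fin n → Matrix (Fin m) (Fin m) ℂ) : Prop
    extends IsSchmidtDecomposition A lam γ δ where
  isHermitian_left : ∀ i, (γ i).IsHermitian
  isHermitian_right : ∀ i, (δ i).IsHermitian

/-- Symmetric with positive coefficients: a positive semidefinite Hermitian matrix that has a
Hermitian Schmidt decomposition of the form `∑ i, lam i • γ i ⊗ γ i`. -/
def IsSPC {k : ℕ} (A : Matrix (Fin k × Fin k) (Fin k × Fin k) ℂ) : Prop :=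
  A.PosSemidef ∧ ∃ (n : ℕ) (lam : Fin n → ℝ) (γ : Fin n → Matrix (Fin k) (Fin k) ℂ),
    IsHermitianSchmidtDecomposition A lam γ γ

/-- `D = ∑ i, γ' i ⊗ γ' i` is a Hermitian Schmidt decomposition (all coefficients are `1`) into
positive semidefinite matrices. -/
def IsPosSchmidtDecomposition {k s : ℕ} (D : Matrix (Fin k × Fin k) (Fin k × Fin k) ℂ)
    (γ' : Fin s → Matrix (Fin k) (Fin k) ℂ) : Prop :=
  IsHermitianSchmidtDecomposition D (fun _ => 1) γ' γ' ∧ ∀ i, (γ' i).PosSemidef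

/-- The image of a matrix, as a subspace of `ℂ^k` with its standard inner product. -/
def image {k : ℕ} (M : Matrix (Fin k) (Fin k) ℂ) : Submodule ℂ (EuclideanSpace ℂ (Fin k)) :=
  LinearMap.range (Matrix.toEuclideanLin M)

/-- The matrix of the Hermitian (orthogonal) projection of `ℂ^k` onto a subspace. -/
def hermProj {k : ℕ} (U : Submodule ℂ (EuclideanSpace ℂ (Fin k))) :
    Matrix (Fin k) (Fin k) ℂ :=
  Matrix.toEuclideanLin.symm (U.starProjection : _ →ₗ[ℂ] _)

/-- The projections `V_1, …, V_{s+1}`: for the first `s` indices the projection onto the image of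
`γ' i`, and for the last index the projection onto the orthogonal complement of the sum of these
images. -/
def splitProj {k s : ℕ} (γ' : Fin s → Matrix (Fin k) (Fin k) ℂ) :
    Fin (s + 1) → Matrix (Fin k) (Fin k) ℂ :=
  Fin.snoc (α := fun _ => Matrix (Fin k) (Fin k) ℂ)
    (fun i => hermProj (image (γ' i))) (hermProj (⨆ i, image (γ' i))ᗮ)

end SplitDecomposition

end

open Matrix

/-! View `A` as the linear map `contract A`, `X ↦ ∑ i, lam i * tr (γ i * X) • γ i`. It is symmetric
for the trace pairing, its largest eigenvalue is `L = lam 0`, and the Hermitian part `E` of the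
`L`-eigenspace is the real span of the first `s` matrices `γ i`. Positivity of `A` makes it a
positive map, so a Perron–Frobenius argument applies: if `X = p - q` in `E` is split into positive
and negative parts, then `p + q` also attains the maximal Rayleigh quotient, whence `p` and `q` lie
in `E`.

Let `δ ≥ 0` lie in `E` and let `V` project onto its image. Then `tr (A (δ ⊗ (1 - V))) = L * tr (δ (1
- V)) = 0`, so positivity gives `A (V ⊗ (1 - V)) = 0`, and likewise with the factors exchanged.
Pairing with the flip turns this into `∑ i, lam i * ‖(1 - V) γ i V‖² = 0`, so `V` commutes with
every `γ i`, and `E` is stable under multiplication by `V`.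

These closure properties let any orthonormal positive semidefinite family in `E` that does not span
be enlarged (`IsPosEigenFamily.exists_succ`), so a maximal one is a basis of `E`; this gives
existence. Orthogonal positive semidefinite matrices have product zero and all their pairings are
nonnegative, which gives uniqueness and makes the images orthogonal. The mixed blocks of `A` then
vanish, and compressions stay SPC by diagonalising a Gram matrix. -/

namespace SplitDecomposition

variable {k n : ℕ}

/-! ### Trace pairings and products of positive semidefinite matrices. -/

section PosSemidef

variable {m : Type*} [Fintype m]

theorem exists_eq_conjTranspose_mul_self {A : Matrix m m ℂ} (hA : A.PosSemidef) :
    ∃ P : Matrix m m ℂ, A = Pᴴ * P := by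
  classical
  open scoped MatrixOrder in
  exact CStarAlgebra.nonneg_iff_eq_star_mul_self.mp hA.nonneg

theorem trace_mul_eq {A B P Q : Matrix m m ℂ} (hP : A = Pᴴ * P) (hQ : B = Qᴴ * Q) :
    trace (A * B) = trace ((P * Qᴴ) * (P * Qᴴ)ᴴ) := by
  rw [hP, hQ, conjTranspose_mul, conjTranspose_conjTranspose, Matrix.mul_assoc, trace_mul_comm]
  simp only [Matrix.mul_assoc]

theorem trace_mul_nonneg {A B : Matrix m m ℂ} (hA : A.PosSemidef) (hB : B.PosSemidef) :
    0 ≤ trace (A * B) := by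
  obtain ⟨P, hP⟩ := exists_eq_conjTranspose_mul_self hA
  obtain ⟨Q, hQ⟩ := exists_eq_conjTranspose_mul_self hB
  rw [trace_mul_eq hP hQ]
  exact (posSemidef_self_mul_conjTranspose _).trace_nonneg

/-- Writing `A = Pᴴ P` and `B = Qᴴ Q`, the trace is the squared norm of `P Qᴴ`, which is a middle
factor of `A B`. -/
theorem mul_eq_zero_of_trace_mul {A B : Matrix m m ℂ} (hA : A.PosSemidef) (hB : B.PosSemidef)
    (h : trace (A * B) = 0) : A * B = 0 := by
  obtain ⟨P, hP⟩ := exists_eq_conjTranspose_mul_self hA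
  obtain ⟨Q, hQ⟩ := exists_eq_conjTranspose_mul_self hB
  rw [trace_mul_eq hP hQ, trace_mul_conjTranspose_self_eq_zero_iff] at h
  rw [hP, hQ, Matrix.mul_assoc, ← Matrix.mul_assoc P, h]
  simp

theorem eq_zero_of_mul_self {A : Matrix m m ℂ} (hA : A.IsHermitian) (h : A * A = 0) : A = 0 := by
  rw [← conjTranspose_mul_self_eq_zero, hA.eq, h]

theorem mul_eq_zero_of_mul_mul {A B : Matrix m m ℂ} (hA : A.IsHermitian) (h : A * (A * B) = 0) :
    A * B = 0 := by
  rw [← conjTranspose_mul_self_eq_zero, conjTranspose_mul, hA.eq, Matrix.mul_assoc, h]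
  simp

theorem exists_posSemidef_sub {X : Matrix m m ℂ} (hX : X.IsHermitian) :
    ∃ p q : Matrix m m ℂ, p.PosSemidef ∧ q.PosSemidef ∧ X = p - q ∧ p * q = 0 ∧ q * p = 0 := by
  classical
  open scoped MatrixOrder in
  exact ⟨X⁺, X⁻, (CFC.posPart_nonneg X).posSemidef, (CFC.negPart_nonneg X).posSemidef,
    (CFC.posPart_sub_negPart X hX).symm, CFC.posPart_mul_negPart X, CFC.negPart_mul_posPart X⟩

theorem trace_mul_ofReal {A B : Matrix m m ℂ} (hA : A.IsHermitian) (hB : B.IsHermitian) :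
    (((trace (A * B)).re : ℝ) : ℂ) = trace (A * B) := by
  refine Complex.conj_eq_iff_re.mp ?_
  have := trace_conjTranspose (A * B)
  rw [conjTranspose_mul, hA.eq, hB.eq, trace_mul_comm] at this
  exact this.symm

end PosSemidef

/-! ### The contraction map attached to `A`. -/

/-- The contraction of the left tensor factor against `X`: `P ⊗ Q` is sent to `tr (P X) Q`. -/
def contract (A : Matrix (Fin k × Fin k) (Fin k × Fin k) ℂ) :
    Matrix (Fin k) (Fin k) ℂ →ₗ[ℂ] Matrix (Fin k) (Fin k) ℂ where
  toFun X := Matrix.of fun b d => ∑ a, ∑ c, A (a, b) (c, d) * X c a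
  map_add' X Y := by
    ext b d
    simp [mul_add, Finset.sum_add_distrib]
  map_smul' r X := by
    ext b d
    simp [Finset.mul_sum, mul_left_comm]

theorem contract_apply (A : Matrix (Fin k × Fin k) (Fin k × Fin k) ℂ)
    (X : Matrix (Fin k) (Fin k) ℂ) (b d : Fin k) :
    contract A X b d = ∑ a, ∑ c, A (a, b) (c, d) * X c a := rfl

/-- Since the trace pairing is nondegenerate, this determines `contract A X`; it is also how
positivity of `A` is transferred to the map. -/
theorem trace_mul_kronecker (A : Matrix (Fin k × Fin k) (Fin k × Fin k) ℂ)
    (X Y : Matrix (Fin k) (Fin k) ℂ) :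
    trace (A * (X ⊗ₖ Y)) = trace (contract A X * Y) := by
  simp only [trace, diag_apply, mul_apply, contract_apply, kronecker_apply,
    Fintype.sum_prod_type, Finset.sum_mul]
  rw [Finset.sum_comm]
  refine Finset.sum_congr rfl fun b _ => ?_
  have h : ∀ a c, ∑ d, A (a, b) (c, d) * (X c a * Y d b) = ∑ d, A (a, b) (c, d) * X c a * Y d b :=
    fun a c => Finset.sum_congr rfl fun d _ => by ring
  simp only [h]
  conv_rhs => rw [Finset.sum_comm]
  refine Finset.sum_congr rfl fun a _ => ?_
  rw [Finset.sum_comm]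

theorem contract_sum {ι : Type*} [Fintype ι]
    (c : ι → ℂ) (P Q : ι → Matrix (Fin k) (Fin k) ℂ) (X : Matrix (Fin k) (Fin k) ℂ) :
    contract (∑ i, c i • (P i ⊗ₖ Q i)) X = ∑ i, (c i * trace (P i * X)) • Q i := by
  refine Matrix.ext_iff_trace_mul_right.mpr fun Y => ?_
  rw [← trace_mul_kronecker]
  simp only [Matrix.sum_mul, trace_sum, smul_mul, trace_smul, ← mul_kronecker_mul, trace_kronecker,
    smul_eq_mul, mul_assoc]

theorem contract_mul_kronecker (A : Matrix (Fin k × Fin k) (Fin k × Fin k) ℂ)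
    (P Q X : Matrix (Fin k) (Fin k) ℂ) :
    contract (A * (P ⊗ₖ Q)) X = contract A (P * X) * Q := by
  refine Matrix.ext_iff_trace_mul_right.mpr fun Y => ?_
  rw [← trace_mul_kronecker, Matrix.mul_assoc A, Matrix.mul_assoc (contract A _),
    ← mul_kronecker_mul, trace_mul_kronecker]

/-! ### Orthogonal projections onto images. -/

theorem hermProj_isHermitian (U : Submodule ℂ (EuclideanSpace ℂ (Fin k))) :
    (hermProj U).IsHermitian := by
  rw [← isSymmetric_toEuclideanLin_iff, hermProj, LinearEquiv.apply_symm_apply]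
  exact U.starProjection_isSymmetric

theorem toEuclideanLin_hermProj (U : Submodule ℂ (EuclideanSpace ℂ (Fin k)))
    (x : EuclideanSpace ℂ (Fin k)) :
    toEuclideanLin (hermProj U) x = U.starProjection x := by
  rw [hermProj, LinearEquiv.apply_symm_apply]; rfl

theorem toEuclideanLin_mul_apply (M N : Matrix (Fin k) (Fin k) ℂ)
    (x : EuclideanSpace ℂ (Fin k)) :
    toEuclideanLin (M * N) x = toEuclideanLin M (toEuclideanLin N x) := by
  simp [toLpLin_apply]

theorem ext_toEuclideanLin {M N : Matrix (Fin k) (Fin k) ℂ}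
    (h : ∀ x, toEuclideanLin M x = toEuclideanLin N x) : M = N :=
  toEuclideanLin.injective (LinearMap.ext h)

theorem hermProj_mul_self (U : Submodule ℂ (EuclideanSpace ℂ (Fin k))) :
    hermProj U * hermProj U = hermProj U := by
  refine ext_toEuclideanLin fun x => ?_
  rw [toEuclideanLin_mul_apply, toEuclideanLin_hermProj, toEuclideanLin_hermProj]
  exact Submodule.starProjection_eq_self_iff.mpr (U.starProjection_apply_mem x)

theorem hermProj_image_mul (M : Matrix (Fin k) (Fin k) ℂ) : hermProj (image M) * M = M := by
  refine ext_toEuclideanLin fun x => ?_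
  rw [toEuclideanLin_mul_apply, toEuclideanLin_hermProj]
  exact Submodule.starProjection_eq_self_iff.mpr ⟨x, rfl⟩

theorem mul_hermProj_image {M : Matrix (Fin k) (Fin k) ℂ} (hM : M.IsHermitian) :
    M * hermProj (image M) = M := by
  have := congrArg conjTranspose (hermProj_image_mul M)
  rwa [conjTranspose_mul, hM.eq, (hermProj_isHermitian _).eq] at this

/-- Every column of the projection lies in the image. This lets an annihilation statement about `M`
pass to its projection. -/
theorem exists_hermProj_image_eq (M : Matrix (Fin k) (Fin k) ℂ) :
    ∃ N, hermProj (image M) = M * N := by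
  have h : ∀ j : Fin k, ∃ y : EuclideanSpace ℂ (Fin k), toEuclideanLin M y =
      toEuclideanLin (hermProj (image M)) (EuclideanSpace.single j 1) := fun j => by
    rw [toEuclideanLin_hermProj]
    exact (image M).starProjection_apply_mem _
  choose y hy using h
  refine ⟨Matrix.of fun i j => y j i, ?_⟩
  ext i j
  have := congrArg (fun v : EuclideanSpace ℂ (Fin k) => v i) (hy j)
  simp only [ofLp_toLpLin, toLin'_apply, PiLp.ofLp_single, mulVec_single_one] at this
  rw [show hermProj (image M) i j = (hermProj (image M)).col j i from rfl, ← this]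
  rfl

theorem hermProj_image_mul_eq_zero {M Z : Matrix (Fin k) (Fin k) ℂ} (hM : M.IsHermitian)
    (h : M * Z = 0) : hermProj (image M) * Z = 0 := by
  obtain ⟨N, hN⟩ := exists_hermProj_image_eq M
  rw [← (hermProj_isHermitian (image M)).eq, hN, conjTranspose_mul, hM.eq, Matrix.mul_assoc, h,
    Matrix.mul_zero]

theorem hermProj_orthogonal (U : Submodule ℂ (EuclideanSpace ℂ (Fin k))) :
    hermProj Uᗮ = 1 - hermProj U := by
  refine ext_toEuclideanLin fun x => ?_
  rw [map_sub, LinearMap.sub_apply, toEuclideanLin_hermProj, toEuclideanLin_hermProj,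
    Submodule.starProjection_orthogonal_val]
  simp

theorem posSemidef_hermProj (U : Submodule ℂ (EuclideanSpace ℂ (Fin k))) :
    (hermProj U).PosSemidef := by
  rw [← hermProj_mul_self]
  nth_rw 1 [← (hermProj_isHermitian U).eq]
  exact posSemidef_conjTranspose_mul_self _

theorem posSemidef_one_sub_hermProj (U : Submodule ℂ (EuclideanSpace ℂ (Fin k))) :
    (1 - hermProj U).PosSemidef := by
  rw [← hermProj_orthogonal]
  exact posSemidef_hermProj _

theorem hermProj_iSup {s : ℕ} {V : Fin s → Submodule ℂ (EuclideanSpace ℂ (Fin k))}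
    (h : Pairwise fun i j => hermProj (V i) * hermProj (V j) = 0) :
    hermProj (⨆ i, V i) = ∑ i, hermProj (V i) := by
  refine ext_toEuclideanLin fun x => ?_
  rw [toEuclideanLin_hermProj]
  symm
  have hx : toEuclideanLin (∑ i, hermProj (V i)) x = ∑ i, (V i).starProjection x := by
    rw [map_sum, LinearMap.sum_apply]
    exact Finset.sum_congr rfl fun i _ => toEuclideanLin_hermProj _ _
  rw [hx]
  refine (Submodule.eq_starProjection_of_mem_orthogonal ?_ ?_).symm
  · exact Submodule.sum_mem _ fun i _ =>
      Submodule.mem_iSup_of_mem i ((V i).starProjection_apply_mem x)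
  · rw [← Submodule.iInf_orthogonal, Submodule.mem_iInf]
    intro j
    rw [← Submodule.starProjection_apply_eq_zero_iff, map_sub, map_sum, Finset.sum_eq_single j]
    · rw [sub_eq_zero]
      exact (Submodule.starProjection_eq_self_iff.mpr ((V j).starProjection_apply_mem x)).symm
    · intro i _ hij
      rw [← toEuclideanLin_hermProj, ← toEuclideanLin_hermProj, ← toEuclideanLin_mul_apply,
        h hij.symm]
      simp
    · simp

theorem iSupIndep_of_hermProj_mul {s : ℕ} {V : Fin s → Submodule ℂ (EuclideanSpace ℂ (Fin k))}
    (h : Pairwise fun i j => hermProj (V i) * hermProj (V j) = 0) : iSupIndep V := by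
  refine OrthogonalFamily.independent ((orthogonalFamily_iff_pairwise).mpr fun i j hij => ?_)
  intro x hx
  rw [← Submodule.starProjection_apply_eq_zero_iff, ← Submodule.starProjection_eq_self_iff.mpr hx,
    ← toEuclideanLin_hermProj, ← toEuclideanLin_hermProj, ← toEuclideanLin_mul_apply,
    h hij.symm]
  simp

/-! ### Orthonormal Hermitian families: Pythagoras and Bessel. -/

theorem TraceOrthonormal.trace_mul {f : Fin n → Matrix (Fin k) (Fin k) ℂ}
    (hf : TraceOrthonormal f) (hh : ∀ i, (f i).IsHermitian) (i j : Fin n) :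
    trace (f i * f j) = if i = j then 1 else 0 := by
  rw [← hf i j, (hh j).eq]

theorem trace_mul_sum (f : Fin n → Matrix (Fin k) (Fin k) ℂ) (c : Fin n → ℂ)
    (X : Matrix (Fin k) (Fin k) ℂ) :
    trace (X * ∑ i, c i • f i) = ∑ i, c i * trace (X * f i) := by
  simp [Matrix.mul_sum, trace_sum]

theorem TraceOrthonormal.trace_mul_combination {f : Fin n → Matrix (Fin k) (Fin k) ℂ}
    (hf : TraceOrthonormal f) (hh : ∀ i, (f i).IsHermitian) (c : Fin n → ℂ) (j : Fin n) :
    trace (f j * ∑ i, c i • f i) = c j := by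
  simp [trace_mul_sum, hf.trace_mul hh]

theorem isHermitian_combination {f : Fin n → Matrix (Fin k) (Fin k) ℂ}
    (hh : ∀ i, (f i).IsHermitian) {X : Matrix (Fin k) (Fin k) ℂ} (hX : X.IsHermitian) :
    (∑ i, trace (f i * X) • f i).IsHermitian := by
  simp only [IsHermitian, conjTranspose_sum, conjTranspose_smul]
  refine Finset.sum_congr rfl fun i _ => ?_
  rw [(hh i).eq, ← trace_mul_ofReal (hh i) hX]
  simp

theorem TraceOrthonormal.trace_residual {f : Fin n → Matrix (Fin k) (Fin k) ℂ}
    (hf : TraceOrthonormal f) (hh : ∀ i, (f i).IsHermitian) (X : Matrix (Fin k) (Fin k) ℂ) :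
    trace ((X - ∑ i, trace (f i * X) • f i) * (X - ∑ i, trace (f i * X) • f i)) =
      trace (X * X) - ∑ i, trace (f i * X) * trace (f i * X) := by
  set Y := ∑ i, trace (f i * X) • f i with hY
  have h1 : trace (X * Y) = ∑ i, trace (f i * X) * trace (f i * X) := by
    rw [hY, trace_mul_sum]
    exact Finset.sum_congr rfl fun i _ => by rw [trace_mul_comm X]
  have h2 : trace (Y * Y) = ∑ i, trace (f i * X) * trace (f i * X) := by
    conv_lhs => rw [hY, trace_mul_sum, ← hY]
    refine Finset.sum_congr rfl fun i _ => ?_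
    rw [trace_mul_comm Y, hY, hf.trace_mul_combination hh]
  rw [Matrix.sub_mul, Matrix.mul_sub, Matrix.mul_sub, trace_sub, trace_sub, trace_sub,
    trace_mul_comm Y X, h1, h2]
  ring

theorem trace_mul_self_nonneg {X : Matrix (Fin k) (Fin k) ℂ} (hX : X.IsHermitian) :
    0 ≤ (trace (X * X)).re := by
  have := (posSemidef_self_mul_conjTranspose X).trace_nonneg
  rw [hX.eq] at this
  exact (Complex.nonneg_iff.mp this).1

theorem eq_zero_of_trace_mul_self {X : Matrix (Fin k) (Fin k) ℂ} (hX : X.IsHermitian)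
    (h : (trace (X * X)).re = 0) : X = 0 := by
  rw [← trace_mul_conjTranspose_self_eq_zero_iff, hX.eq, ← trace_mul_ofReal hX hX, h]
  simp

theorem TraceOrthonormal.bessel {f : Fin n → Matrix (Fin k) (Fin k) ℂ}
    (hf : TraceOrthonormal f) (hh : ∀ i, (f i).IsHermitian) {X : Matrix (Fin k) (Fin k) ℂ}
    (hX : X.IsHermitian) : ∑ i, (trace (f i * X)).re ^ 2 ≤ (trace (X * X)).re := by
  have h := trace_mul_self_nonneg (hX.sub (isHermitian_combination hh hX))
  rw [hf.trace_residual hh, Complex.sub_re, Complex.re_sum] at h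
  have h2 : ∀ i, (trace (f i * X) * trace (f i * X)).re = (trace (f i * X)).re ^ 2 := fun i => by
    rw [← trace_mul_ofReal (hh i) hX]; norm_cast; ring
  simp only [h2] at h
  linarith

/-- The equality case of Bessel: the residual has squared norm zero. -/
theorem TraceOrthonormal.eq_combination {f : Fin n → Matrix (Fin k) (Fin k) ℂ}
    (hf : TraceOrthonormal f) (hh : ∀ i, (f i).IsHermitian) {X : Matrix (Fin k) (Fin k) ℂ}
    (hX : X.IsHermitian) (h : (trace (X * X)).re ≤ ∑ i, (trace (f i * X)).re ^ 2) :
    X = ∑ i, trace (f i * X) • f i := by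
  rw [← sub_eq_zero]
  refine eq_zero_of_trace_mul_self (hX.sub (isHermitian_combination hh hX)) ?_
  refine le_antisymm ?_ (trace_mul_self_nonneg (hX.sub (isHermitian_combination hh hX)))
  rw [hf.trace_residual hh, Complex.sub_re, Complex.re_sum]
  have h2 : ∀ i, (trace (f i * X) * trace (f i * X)).re = (trace (f i * X)).re ^ 2 := fun i => by
    rw [← trace_mul_ofReal (hh i) hX]; norm_cast; ring
  simp only [h2]
  linarith

/-! ### The top eigenspace and its closure properties. -/

/-- `X` is a Hermitian eigenvector of `contract A` for the eigenvalue `L`. -/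
structure IsEigen (A : Matrix (Fin k × Fin k) (Fin k × Fin k) ℂ) (L : ℝ)
    (X : Matrix (Fin k) (Fin k) ℂ) : Prop where
  herm : X.IsHermitian
  eq : contract A X = (L : ℂ) • X

section Eigen

variable {A : Matrix (Fin k × Fin k) (Fin k × Fin k) ℂ} {L : ℝ}

theorem IsEigen.add {X Y : Matrix (Fin k) (Fin k) ℂ} (hX : IsEigen A L X) (hY : IsEigen A L Y) :
    IsEigen A L (X + Y) :=
  ⟨hX.herm.add hY.herm, by rw [map_add, hX.eq, hY.eq, smul_add]⟩

theorem IsEigen.sub {X Y : Matrix (Fin k) (Fin k) ℂ} (hX : IsEigen A L X) (hY : IsEigen A L Y) :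
    IsEigen A L (X - Y) :=
  ⟨hX.herm.sub hY.herm, by rw [map_sub, hX.eq, hY.eq, smul_sub]⟩

theorem isHermitian_ofReal_smul {X : Matrix (Fin k) (Fin k) ℂ} (hX : X.IsHermitian) (r : ℝ) :
    ((r : ℂ) • X).IsHermitian := by
  rw [IsHermitian, conjTranspose_smul, hX.eq]
  simp

theorem IsEigen.smul {X : Matrix (Fin k) (Fin k) ℂ} (hX : IsEigen A L X) (r : ℝ) :
    IsEigen A L ((r : ℂ) • X) :=
  ⟨isHermitian_ofReal_smul hX.herm r, by rw [map_smul, hX.eq, smul_comm]⟩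

theorem IsEigen.combination {f : Fin n → Matrix (Fin k) (Fin k) ℂ}
    (hf : ∀ i, IsEigen A L (f i)) {X : Matrix (Fin k) (Fin k) ℂ} (hX : X.IsHermitian) :
    IsEigen A L (∑ i, trace (f i * X) • f i) := by
  refine ⟨isHermitian_combination (fun i => (hf i).herm) hX, ?_⟩
  rw [map_sum, Finset.smul_sum]
  exact Finset.sum_congr rfl fun i _ => by rw [map_smul, (hf i).eq, smul_comm]

variable {lam : Fin n → ℝ} {γ : Fin n → Matrix (Fin k) (Fin k) ℂ}

theorem IsSchmidtDecomposition.contract_eq {δ : Fin n → Matrix (Fin k) (Fin k) ℂ}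
    (h : IsSchmidtDecomposition A lam γ δ)
    (X : Matrix (Fin k) (Fin k) ℂ) :
    contract A X = ∑ i, ((lam i : ℂ) * trace (γ i * X)) • δ i := by
  rw [h.eq_sum, contract_sum]

theorem IsHermitianSchmidtDecomposition.trace_contract_comm
    (h : IsHermitianSchmidtDecomposition A lam γ γ) (X Y : Matrix (Fin k) (Fin k) ℂ) :
    trace (contract A X * Y) = trace (contract A Y * X) := by
  rw [h.contract_eq, h.contract_eq]
  simp only [Matrix.sum_mul, trace_sum, smul_mul, trace_smul, smul_eq_mul]
  exact Finset.sum_congr rfl fun i _ => by ring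

/-- Variational principle. With `x i = tr (γ i * X)`, the chain `∑ lam i * x i² ≤ L ∑ x i² ≤ L tr
(X²)` must consist of equalities: the second puts `X` in the span of the `γ i`, the first kills `x
i` unless `lam i = L`. -/
theorem IsHermitianSchmidtDecomposition.isEigen_of_le
    (h : IsHermitianSchmidtDecomposition A lam γ γ) (hL : 0 < L) (hlam : ∀ i, lam i ≤ L)
    {X : Matrix (Fin k) (Fin k) ℂ} (hX : X.IsHermitian)
    (hle : L * (trace (X * X)).re ≤ (trace (contract A X * X)).re) : IsEigen A L X := by
  have hg := h.isHermitian_left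
  have ho := h.orthonormal_left
  have hq : (trace (contract A X * X)).re = ∑ i, lam i * (trace (γ i * X)).re ^ 2 := by
    rw [h.contract_eq]
    simp only [Matrix.sum_mul, trace_sum, smul_mul, trace_smul, smul_eq_mul, Complex.re_sum]
    refine Finset.sum_congr rfl fun i _ => ?_
    rw [← trace_mul_ofReal (hg i) hX]
    norm_cast
    ring
  have hb := ho.bessel hg hX
  have h1 : ∀ i ∈ Finset.univ, 0 ≤ (L - lam i) * (trace (γ i * X)).re ^ 2 := fun i _ =>
    mul_nonneg (sub_nonneg.mpr (hlam i)) (sq_nonneg _)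
  have h2 : ∑ i, (L - lam i) * (trace (γ i * X)).re ^ 2 =
      L * ∑ i, (trace (γ i * X)).re ^ 2 - ∑ i, lam i * (trace (γ i * X)).re ^ 2 := by
    rw [Finset.mul_sum, ← Finset.sum_sub_distrib]
    exact Finset.sum_congr rfl fun i _ => by ring
  have h3 := Finset.sum_nonneg h1
  have h4 := mul_le_mul_of_nonneg_left hb hL.le
  have h5 : ∑ i, (L - lam i) * (trace (γ i * X)).re ^ 2 = 0 := by linarith
  have h6 := (Finset.sum_eq_zero_iff_of_nonneg h1).mp h5
  have h7 := ho.eq_combination hg hX (le_of_mul_le_mul_left (by linarith) hL)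
  refine ⟨hX, ?_⟩
  rw [h.contract_eq]
  conv_rhs => rw [h7, Finset.smul_sum]
  refine Finset.sum_congr rfl fun i hi => ?_
  rw [smul_smul]
  congr 1
  rw [← trace_mul_ofReal (hg i) hX]
  have := h6 i hi
  norm_cast
  rcases mul_eq_zero.mp this with h8 | h8
  · rw [sub_eq_zero.mp h8]
  · rw [pow_eq_zero_iff two_ne_zero] at h8
    rw [h8]; simp

theorem trace_contract_nonneg (hA : A.PosSemidef) {p q : Matrix (Fin k) (Fin k) ℂ}
    (hp : p.PosSemidef) (hq : q.PosSemidef) : 0 ≤ (trace (contract A p * q)).re := by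
  rw [← trace_mul_kronecker]
  exact (Complex.nonneg_iff.mp (trace_mul_nonneg hA (hp.kronecker hq))).1

/-- Perron–Frobenius step: replacing `p - q` by `p + q` keeps the norm, as `p q = q p = 0`, and does
not decrease the quadratic form, as the cross terms are nonnegative. -/
theorem IsHermitianSchmidtDecomposition.exists_isEigen_posSemidef_sub
    (h : IsHermitianSchmidtDecomposition A lam γ γ) (hA : A.PosSemidef) (hL : 0 < L)
    (hlam : ∀ i, lam i ≤ L) {X : Matrix (Fin k) (Fin k) ℂ} (hX : IsEigen A L X) :
    ∃ p q, p.PosSemidef ∧ q.PosSemidef ∧ IsEigen A L p ∧ IsEigen A L q ∧ X = p - q ∧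
      p * q = 0 ∧ q * p = 0 := by
  obtain ⟨p, q, hp, hq, hXpq, hpq, hqp⟩ := exists_posSemidef_sub hX.herm
  have hr : IsEigen A L (p + q) := by
    refine h.isEigen_of_le hL hlam (hp.isHermitian.add hq.isHermitian) ?_
    have h1 : trace ((p + q) * (p + q)) = trace (X * X) := by
      rw [hXpq]
      simp [Matrix.add_mul, Matrix.mul_add, Matrix.sub_mul, Matrix.mul_sub, hpq, hqp]
    have h2 : (trace (contract A X * X)).re = L * (trace (X * X)).re := by
      rw [hX.eq, smul_mul, trace_smul, smul_eq_mul, Complex.re_ofReal_mul]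
    rw [h1, ← h2, hXpq]
    have h3 := trace_contract_nonneg hA hp hq
    have h4 := trace_contract_nonneg hA hq hp
    simp only [map_add, map_sub, Matrix.add_mul, Matrix.mul_add, Matrix.sub_mul, Matrix.mul_sub,
      trace_add, trace_sub, Complex.add_re, Complex.sub_re]
    linarith
  have hp2 : p = ((1 / 2 : ℝ) : ℂ) • ((p + q) + X) := by
    rw [hXpq]; push_cast; module
  have hq2 : q = ((1 / 2 : ℝ) : ℂ) • ((p + q) - X) := by
    rw [hXpq]; push_cast; module
  exact ⟨p, q, hp, hq, hp2 ▸ (hr.add hX).smul _, hq2 ▸ (hr.sub hX).smul _, hXpq, hpq, hqp⟩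

theorem mul_kronecker_eq_zero (hA : A.PosSemidef)
    {δ : Matrix (Fin k) (Fin k) ℂ} (hδ : δ.PosSemidef) (hW : IsEigen A L δ) :
    A * (hermProj (image δ) ⊗ₖ (1 - hermProj (image δ))) = 0 := by
  have h1 : A * (δ ⊗ₖ (1 - hermProj (image δ))) = 0 := by
    -- The trace contracts to `L * tr (δ (1 - V))`, which vanishes because `δ V = δ`.
    refine mul_eq_zero_of_trace_mul hA (hδ.kronecker (posSemidef_one_sub_hermProj _)) ?_
    rw [trace_mul_kronecker, hW.eq, smul_mul, Matrix.mul_sub, mul_hermProj_image hδ.isHermitian]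
    simp
  obtain ⟨N, hN⟩ := exists_hermProj_image_eq δ
  have h2 : (hermProj (image δ) ⊗ₖ (1 - hermProj (image δ))) =
      (δ ⊗ₖ (1 - hermProj (image δ))) * (N ⊗ₖ 1) := by
    rw [← mul_kronecker_mul, ← hN, Matrix.mul_one]
  rw [h2, ← Matrix.mul_assoc, h1, Matrix.zero_mul]

theorem IsHermitianSchmidtDecomposition.mul_kronecker_eq_zero'
    (h : IsHermitianSchmidtDecomposition A lam γ γ) (hA : A.PosSemidef)
    {δ : Matrix (Fin k) (Fin k) ℂ} (hδ : δ.PosSemidef) (hW : IsEigen A L δ) :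
    A * ((1 - hermProj (image δ)) ⊗ₖ hermProj (image δ)) = 0 := by
  have h1 : A * ((1 - hermProj (image δ)) ⊗ₖ δ) = 0 := by
    refine mul_eq_zero_of_trace_mul hA ((posSemidef_one_sub_hermProj _).kronecker hδ) ?_
    rw [trace_mul_kronecker, h.trace_contract_comm, hW.eq, smul_mul, Matrix.mul_sub,
      mul_hermProj_image hδ.isHermitian]
    simp
  obtain ⟨N, hN⟩ := exists_hermProj_image_eq δ
  have h2 : ((1 - hermProj (image δ)) ⊗ₖ hermProj (image δ)) =
      ((1 - hermProj (image δ)) ⊗ₖ δ) * (1 ⊗ₖ N) := by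
    rw [← mul_kronecker_mul, ← hN, Matrix.mul_one]
  rw [h2, ← Matrix.mul_assoc, h1, Matrix.zero_mul]

/-- The trace of the flip times a matrix: `P ⊗ Q` is sent to `tr (P Q)`. -/
theorem sum_flip_kronecker (P Q : Matrix (Fin k) (Fin k) ℂ) :
    ∑ a, ∑ b, (P ⊗ₖ Q) (a, b) (b, a) = trace (P * Q) := by
  simp [trace, mul_apply]

theorem sum_flip_sum (c : Fin n → ℂ) (P Q : Fin n → Matrix (Fin k) (Fin k) ℂ) :
    ∑ a, ∑ b, (∑ i, c i • (P i ⊗ₖ Q i)) (a, b) (b, a) = ∑ i, c i * trace (P i * Q i) := by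
  simp only [Matrix.sum_apply, Matrix.smul_apply, smul_eq_mul, ← sum_flip_kronecker,
    Finset.mul_sum]
  conv_rhs => rw [Finset.sum_comm]
  refine Finset.sum_congr rfl fun a _ => ?_
  rw [Finset.sum_comm]

/-- The vanishing block `((1 - V) ⊗ V) A (V ⊗ (1 - V))` is a sum of terms `lam i • (Z ⊗ Zᴴ)` with `Z
= (1 - V) γ i V`. The flip trace of each is `lam i * ‖Z‖² ≥ 0`, so every `Z` is zero. -/
theorem IsHermitianSchmidtDecomposition.commute_hermProj
    (h : IsHermitianSchmidtDecomposition A lam γ γ) (hA : A.PosSemidef)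
    {δ : Matrix (Fin k) (Fin k) ℂ} (hδ : δ.PosSemidef) (hW : IsEigen A L δ) (i : Fin n) :
    γ i * hermProj (image δ) = hermProj (image δ) * γ i := by
  set V := hermProj (image δ) with hV
  have hVh : V.IsHermitian := hermProj_isHermitian _
  have hWh : (1 - V).IsHermitian := isHermitian_one.sub hVh
  have h0 : ((1 - V) ⊗ₖ V) * (A * (V ⊗ₖ (1 - V))) = 0 := by
    rw [mul_kronecker_eq_zero hA hδ hW, Matrix.mul_zero]
  have h1 : ((1 - V) ⊗ₖ V) * (A * (V ⊗ₖ (1 - V))) =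
      ∑ i, (lam i : ℂ) • (((1 - V) * γ i * V) ⊗ₖ (V * γ i * (1 - V))) := by
    rw [h.eq_sum]
    simp only [Matrix.sum_mul, Matrix.mul_sum, smul_mul, Matrix.mul_smul, ← mul_kronecker_mul,
      Matrix.mul_assoc]
  have hct : ∀ i, V * γ i * (1 - V) = ((1 - V) * γ i * V)ᴴ := fun i => by
    rw [conjTranspose_mul, conjTranspose_mul, hVh.eq, hWh.eq, (h.isHermitian_left i).eq,
      Matrix.mul_assoc]
  have h2 := sum_flip_sum (fun i => (lam i : ℂ)) (fun i => (1 - V) * γ i * V)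
    (fun i => V * γ i * (1 - V))
  rw [← h1, h0] at h2
  simp only [Matrix.zero_apply, Finset.sum_const_zero] at h2
  have h3 : ∀ j ∈ Finset.univ,
      (0 : ℂ) ≤ (lam j : ℂ) * trace ((1 - V) * γ j * V * (V * γ j * (1 - V))) := fun j _ => by
    rw [hct]
    exact mul_nonneg (by exact_mod_cast (h.pos j).le)
      (posSemidef_self_mul_conjTranspose _).trace_nonneg
  have h4 := (Finset.sum_eq_zero_iff_of_nonneg h3).mp h2.symm i (Finset.mem_univ i)
  rcases mul_eq_zero.mp h4 with h5 | h5
  · exact absurd (by exact_mod_cast h5) (h.pos i).ne'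
  rw [hct, trace_mul_conjTranspose_self_eq_zero_iff] at h5
  have h6 := hct i
  rw [h5, conjTranspose_zero, Matrix.mul_sub, Matrix.mul_one, sub_eq_zero] at h6
  rw [Matrix.sub_mul, Matrix.sub_mul, Matrix.one_mul, sub_eq_zero] at h5
  rw [h5, ← h6]

theorem IsHermitianSchmidtDecomposition.isEigen_commute_hermProj
    (h : IsHermitianSchmidtDecomposition A lam γ γ) (hA : A.PosSemidef) (hL : 0 < L)
    {δ : Matrix (Fin k) (Fin k) ℂ} (hδ : δ.PosSemidef) (hW : IsEigen A L δ)
    {ε : Matrix (Fin k) (Fin k) ℂ} (hε : IsEigen A L ε) :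
    ε * hermProj (image δ) = hermProj (image δ) * ε := by
  have hL' : (L : ℂ) ≠ 0 := by exact_mod_cast hL.ne'
  refine smul_right_injective _ hL' ?_
  simp only
  rw [← smul_mul, ← Matrix.mul_smul, ← hε.eq, h.contract_eq, Matrix.sum_mul, Matrix.mul_sum]
  refine Finset.sum_congr rfl fun i _ => ?_
  rw [smul_mul, Matrix.mul_smul, h.commute_hermProj hA hδ hW]

theorem IsHermitianSchmidtDecomposition.isEigen_mul_hermProj
    (h : IsHermitianSchmidtDecomposition A lam γ γ) (hA : A.PosSemidef) (hL : 0 < L)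
    {δ : Matrix (Fin k) (Fin k) ℂ} (hδ : δ.PosSemidef) (hW : IsEigen A L δ)
    {ε : Matrix (Fin k) (Fin k) ℂ} (hε : IsEigen A L ε) :
    IsEigen A L (ε * hermProj (image δ)) := by
  have hc := h.isEigen_commute_hermProj hA hL hδ hW hε
  refine ⟨?_, ?_⟩
  · rw [IsHermitian, conjTranspose_mul, hε.herm.eq, (hermProj_isHermitian _).eq, hc]
  · have h1 := contract_mul_kronecker A (hermProj (image δ)) (1 - hermProj (image δ)) ε
    have h2 := contract_mul_kronecker A (1 - hermProj (image δ)) (hermProj (image δ)) ε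
    have h0 : contract (0 : Matrix (Fin k × Fin k) (Fin k × Fin k) ℂ) ε = 0 := by
      ext b d; simp [contract_apply]
    rw [mul_kronecker_eq_zero hA hδ hW, h0, Matrix.mul_sub, Matrix.mul_one] at h1
    rw [h.mul_kronecker_eq_zero' hA hδ hW, h0, Matrix.sub_mul, Matrix.one_mul, map_sub,
      Matrix.sub_mul, hε.eq] at h2
    rw [hc, sub_eq_zero.mp h1.symm, ← sub_eq_zero.mp h2.symm, smul_mul, hc]

end Eigen

/-! ### Enlarging positive orthonormal families in the eigenspace. -/

/-- An orthonormal family of positive semidefinite eigenvectors of `contract A`. -/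
structure IsPosEigenFamily {t : ℕ} (A : Matrix (Fin k × Fin k) (Fin k × Fin k) ℂ) (L : ℝ)
    (f : Fin t → Matrix (Fin k) (Fin k) ℂ) : Prop where
  isEigen : ∀ i, IsEigen A L (f i)
  pos : ∀ i, (f i).PosSemidef
  orthonormal : TraceOrthonormal f

theorem TraceOrthonormal.mul_eq_zero {t : ℕ} {f : Fin t → Matrix (Fin k) (Fin k) ℂ}
    (hf : TraceOrthonormal f) (hp : ∀ i, (f i).PosSemidef) {i j : Fin t} (hij : i ≠ j) :
    f i * f j = 0 :=
  mul_eq_zero_of_trace_mul (hp i) (hp j) <| by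
    rw [hf.trace_mul fun i => (hp i).isHermitian, if_neg hij]

section Eigen

variable {A : Matrix (Fin k × Fin k) (Fin k × Fin k) ℂ} {L : ℝ}
  {lam : Fin n → ℝ} {γ : Fin n → Matrix (Fin k) (Fin k) ℂ}

/-- A nonzero positive semidefinite matrix can be normalised. -/
theorem exists_normalize {p : Matrix (Fin k) (Fin k) ℂ} (hp : p.PosSemidef) (h0 : p ≠ 0) :
    ∃ r : ℝ, 0 < r ∧ trace (((r : ℂ) • p) * ((r : ℂ) • p)ᴴ) = 1 := by
  have h1 : 0 < (trace (p * p)).re :=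
    lt_of_le_of_ne (trace_mul_self_nonneg hp.isHermitian)
      fun h => h0 (eq_zero_of_trace_mul_self hp.isHermitian h.symm)
  refine ⟨(√(trace (p * p)).re)⁻¹, by positivity, ?_⟩
  rw [(isHermitian_ofReal_smul hp.isHermitian _).eq, smul_mul, Matrix.mul_smul, trace_smul,
    trace_smul, smul_eq_mul, smul_eq_mul, ← trace_mul_ofReal hp.isHermitian hp.isHermitian]
  norm_cast
  have h2 := Real.sq_sqrt h1.le
  have h3 := Real.sqrt_pos.mpr h1
  rw [← mul_assoc, ← mul_inv, ← sq, h2]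
  exact inv_mul_cancel₀ h1.ne'

theorem posSemidef_ofReal_smul {p : Matrix (Fin k) (Fin k) ℂ} (hp : p.PosSemidef) {r : ℝ}
    (hr : 0 ≤ r) : ((r : ℂ) • p).PosSemidef :=
  hp.smul (by exact_mod_cast hr)

theorem IsPosEigenFamily.snoc {t : ℕ} {f : Fin t → Matrix (Fin k) (Fin k) ℂ}
    (hf : IsPosEigenFamily A L f) {p : Matrix (Fin k) (Fin k) ℂ} (hp : p.PosSemidef)
    (hW : IsEigen A L p) (h0 : p ≠ 0) (hpf : ∀ i, p * f i = 0) :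
    ∃ g : Fin (t + 1) → Matrix (Fin k) (Fin k) ℂ, IsPosEigenFamily A L g := by
  obtain ⟨r, hr, h1⟩ := exists_normalize hp h0
  have hfp : ∀ i, f i * p = 0 := fun i => by
    have := congrArg conjTranspose (hpf i)
    rwa [conjTranspose_mul, hp.isHermitian.eq, (hf.pos i).isHermitian.eq,
      conjTranspose_zero] at this
  refine ⟨Fin.snoc (α := fun _ => Matrix (Fin k) (Fin k) ℂ) f ((r : ℂ) • p), ?_, ?_, ?_⟩
  · refine Fin.lastCases ?_ fun i => ?_
    · rw [Fin.snoc_last]; exact hW.smul r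
    · rw [Fin.snoc_castSucc]; exact hf.isEigen i
  · refine Fin.lastCases ?_ fun i => ?_
    · rw [Fin.snoc_last]; exact posSemidef_ofReal_smul hp hr.le
    · rw [Fin.snoc_castSucc]; exact hf.pos i
  · refine Fin.lastCases ?_ fun i => ?_ <;> refine Fin.lastCases ?_ fun j => ?_
    · simpa only [Fin.snoc_last, if_true] using h1
    · rw [Fin.snoc_last, Fin.snoc_castSucc, if_neg (Fin.castSucc_lt_last j).ne',
        (hf.pos j).isHermitian.eq, smul_mul, hpf]
      simp
    · rw [Fin.snoc_last, Fin.snoc_castSucc, if_neg (Fin.castSucc_lt_last i).ne,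
        (isHermitian_ofReal_smul hp.isHermitian r).eq, Matrix.mul_smul, hfp]
      simp
    · rw [Fin.snoc_castSucc, Fin.snoc_castSucc, hf.orthonormal i j]
      simp [Fin.castSucc_inj]

theorem IsPosEigenFamily.update {t : ℕ} {f : Fin t → Matrix (Fin k) (Fin k) ℂ}
    (hf : IsPosEigenFamily A L f) (j : Fin t) {p : Matrix (Fin k) (Fin k) ℂ} (hp : p.PosSemidef)
    (hW : IsEigen A L p) (h0 : p ≠ 0) (hpf : ∀ i, i ≠ j → p * f i = 0) :
    ∃ r : ℝ, IsPosEigenFamily A L (Function.update f j ((r : ℂ) • p)) := by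
  obtain ⟨r, hr, h1⟩ := exists_normalize hp h0
  have hfp : ∀ i, i ≠ j → f i * p = 0 := fun i hi => by
    have := congrArg conjTranspose (hpf i hi)
    rwa [conjTranspose_mul, hp.isHermitian.eq, (hf.pos i).isHermitian.eq,
      conjTranspose_zero] at this
  refine ⟨r, fun i => ?_, fun i => ?_, fun i i' => ?_⟩
  · rcases eq_or_ne i j with rfl | hi
    · rw [Function.update_self]; exact hW.smul r
    · rw [Function.update_of_ne hi]; exact hf.isEigen i
  · rcases eq_or_ne i j with rfl | hi
    · rw [Function.update_self]; exact posSemidef_ofReal_smul hp hr.le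
    · rw [Function.update_of_ne hi]; exact hf.pos i
  · rcases eq_or_ne i j with rfl | hi <;> rcases eq_or_ne i' i with rfl | hi'
    · simpa using h1
    · rw [Function.update_self, Function.update_of_ne hi', if_neg hi'.symm,
        (hf.pos i').isHermitian.eq, smul_mul, hpf i' hi']
      simp
    · simpa [Function.update_of_ne hi] using hf.orthonormal i' i'
    · rcases eq_or_ne i' j with rfl | hi''
      · rw [Function.update_self, Function.update_of_ne hi, if_neg hi,
          (isHermitian_ofReal_smul hp.isHermitian r).eq, Matrix.mul_smul, hfp i hi]
        simp
      · rw [Function.update_of_ne hi, Function.update_of_ne hi'']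
        exact hf.orthonormal i i'

/-- If `ε` is nonzero on the image of some `f j`, its restriction `η` there is orthogonal to `f j`
and so has both signs: `f j` is replaced by the two parts of `η`. Otherwise `ε` annihilates every `f
i`, and a nonzero part of `ε` is appended. -/
theorem IsPosEigenFamily.exists_succ {t : ℕ} {f : Fin t → Matrix (Fin k) (Fin k) ℂ}
    (hf : IsPosEigenFamily A L f)
    (h : IsHermitianSchmidtDecomposition A lam γ γ) (hA : A.PosSemidef) (hL : 0 < L)
    (hlam : ∀ i, lam i ≤ L) {ε : Matrix (Fin k) (Fin k) ℂ} (hε : IsEigen A L ε) (hε0 : ε ≠ 0)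
    (horth : ∀ i, trace (f i * ε) = 0) :
    ∃ g : Fin (t + 1) → Matrix (Fin k) (Fin k) ℂ, IsPosEigenFamily A L g := by
  have hann : ∀ {p q Y : Matrix (Fin k) (Fin k) ℂ}, p.PosSemidef → p * q = 0 →
      (p - q) * Y = 0 → p * Y = 0 := fun {p q Y} hp hpq hY => by
    refine mul_eq_zero_of_mul_mul hp.isHermitian ?_
    rw [Matrix.sub_mul, sub_eq_zero] at hY
    rw [hY, ← Matrix.mul_assoc, hpq, Matrix.zero_mul]
  by_cases hc : ∃ j, ε * hermProj (image (f j)) ≠ 0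
  · obtain ⟨j, hj⟩ := hc
    have hη := h.isEigen_mul_hermProj hA hL (hf.pos j) (hf.isEigen j) hε
    set η := ε * hermProj (image (f j)) with hηdef
    have hηf : trace (f j * η) = 0 := by
      rw [trace_mul_comm, hηdef, Matrix.mul_assoc, hermProj_image_mul, trace_mul_comm, horth]
    have hsupp : ∀ {Z}, f j * Z = 0 → η * Z = 0 := fun {Z} hZ => by
      rw [hηdef, Matrix.mul_assoc, hermProj_image_mul_eq_zero (hf.pos j).isHermitian hZ,
        Matrix.mul_zero]
    obtain ⟨p, q, hp, hq, hpW, hqW, hpq', hpq, hqp⟩ :=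
      h.exists_isEigen_posSemidef_sub hA hL hlam hη
    have hneg : q - p = -η := by rw [hpq']; abel
    -- If `η = -q`, then `tr (f j * q) = 0` forces `f j * q = 0`; as `η` lives on the image of `f
    -- j`, also `η q = 0`, so `q² = 0` and `η = 0`.
    have hp0 : p ≠ 0 := by
      rintro rfl
      refine hj ?_
      rw [zero_sub] at hpq'
      have h1 : f j * q = 0 := mul_eq_zero_of_trace_mul (hf.pos j) hq <| by
        rw [hpq'] at hηf; simpa using hηf
      have h2 := hsupp h1
      rw [hpq', Matrix.neg_mul, neg_eq_zero] at h2
      rw [hpq', eq_zero_of_mul_self hq.isHermitian h2, neg_zero]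
    have hq0 : q ≠ 0 := by
      rintro rfl
      refine hj ?_
      rw [sub_zero] at hpq'
      have h1 : f j * p = 0 := mul_eq_zero_of_trace_mul (hf.pos j) hp (by rw [← hpq', hηf])
      have h2 := hsupp h1
      rw [hpq'] at h2
      rw [hpq', eq_zero_of_mul_self hp.isHermitian h2]
    have hηi : ∀ i, i ≠ j → η * f i = 0 := fun i hi =>
      hsupp (hf.orthonormal.mul_eq_zero hf.pos hi.symm)
    obtain ⟨r, hg⟩ := hf.update j hp hpW hp0 fun i hi => hann hp hpq (hpq' ▸ hηi i hi)
    refine hg.snoc hq hqW hq0 fun i => ?_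
    rcases eq_or_ne i j with rfl | hi
    · rw [Function.update_self, Matrix.mul_smul, hqp, smul_zero]
    · rw [Function.update_of_ne hi]
      refine hann hq hqp ?_
      rw [hneg, Matrix.neg_mul, hηi i hi, neg_zero]
  · push Not at hc
    have hεf : ∀ i, ε * f i = 0 := fun i => by
      rw [← hermProj_image_mul (f i), ← Matrix.mul_assoc, hc, Matrix.zero_mul]
    obtain ⟨p, q, hp, hq, hpW, hqW, hpq', hpq, hqp⟩ :=
      h.exists_isEigen_posSemidef_sub hA hL hlam hε
    by_cases hp0 : p = 0
    · refine hf.snoc hq hqW (fun hq0 => hε0 (by rw [hpq', hp0, hq0, sub_zero])) fun i => ?_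
      refine hann hq hqp ?_
      rw [← neg_sub, ← hpq', Matrix.neg_mul, hεf, neg_zero]
    · exact hf.snoc hp hpW hp0 fun i => hann hp hpq (hpq' ▸ hεf i)

end Eigen

/-! ### Comparing orthonormal families: uniqueness and existence of the positive basis. -/

/-- Two orthonormal Hermitian families, each contained in the span of the other. -/
theorem card_eq_of_combination {s t : ℕ} {f : Fin t → Matrix (Fin k) (Fin k) ℂ}
    {g : Fin s → Matrix (Fin k) (Fin k) ℂ} (hfo : TraceOrthonormal f) (hgo : TraceOrthonormal g)
    (hf : ∀ i, (f i).IsHermitian) (hg : ∀ i, (g i).IsHermitian)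
    (hfg : ∀ i, f i = ∑ j, trace (g j * f i) • g j)
    (hgf : ∀ j, g j = ∑ i, trace (f i * g j) • f i) : t = s := by
  have h1 : ∀ i, ∑ j, trace (g j * f i) * trace (f i * g j) = 1 := fun i => by
    have h := congrArg (fun X => trace (f i * X)) (hfg i)
    simp only [trace_mul_sum] at h
    rw [← h, hfo.trace_mul hf, if_pos rfl]
  have h2 : ∀ j, ∑ i, trace (g j * f i) * trace (f i * g j) = 1 := fun j => by
    have h := congrArg (fun X => trace (g j * X)) (hgf j)
    simp only [trace_mul_sum] at h
    simp only [mul_comm (trace (g j * _))]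
    rw [← h, hgo.trace_mul hg, if_pos rfl]
  -- The double sum of `tr (g j * f i) * tr (f i * g j)` has all its row sums and column sums equal
  -- to one.
  have h3 : (t : ℂ) = s := by
    have : ∑ i : Fin t, (1 : ℂ) = ∑ j : Fin s, (1 : ℂ) := by
      calc ∑ i : Fin t, (1 : ℂ)
          = ∑ i, ∑ j, trace (g j * f i) * trace (f i * g j) := by simp only [h1]
        _ = ∑ j : Fin s, (1 : ℂ) := by rw [Finset.sum_comm]; simp only [h2]
    simpa using this
  exact_mod_cast h3

theorem sum_smul_kronecker {s : ℕ} (c : Fin s → ℂ) (f : Fin s → Matrix (Fin k) (Fin k) ℂ)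
    (Y : Matrix (Fin k) (Fin k) ℂ) : (∑ i, c i • f i) ⊗ₖ Y = ∑ i, c i • (f i ⊗ₖ Y) := by
  ext ⟨a, b⟩ ⟨c, d⟩
  simp [Matrix.sum_apply, Finset.sum_mul, mul_assoc]

theorem kronecker_sum_smul {s : ℕ} (c : Fin s → ℂ) (f : Fin s → Matrix (Fin k) (Fin k) ℂ)
    (Y : Matrix (Fin k) (Fin k) ℂ) : Y ⊗ₖ (∑ i, c i • f i) = ∑ i, c i • (Y ⊗ₖ f i) := by
  ext ⟨a, b⟩ ⟨c, d⟩
  simp [Matrix.sum_apply, Finset.mul_sum, mul_left_comm]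

theorem sum_kronecker_eq_of_combination {s t : ℕ} {f : Fin t → Matrix (Fin k) (Fin k) ℂ}
    {g : Fin s → Matrix (Fin k) (Fin k) ℂ}
    (hfg : ∀ i, f i = ∑ j, trace (g j * f i) • g j)
    (hgf : ∀ j, g j = ∑ i, trace (f i * g j) • f i) :
    ∑ j, g j ⊗ₖ g j = ∑ i, f i ⊗ₖ f i := by
  have h1 : ∀ i, f i ⊗ₖ f i = ∑ j, trace (g j * f i) • (g j ⊗ₖ f i) := fun i => by
    rw [← sum_smul_kronecker, ← hfg]
  have h2 : ∀ j, g j ⊗ₖ g j = ∑ i, trace (f i * g j) • (g j ⊗ₖ f i) := fun j => by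
    rw [← kronecker_sum_smul, ← hgf]
  simp only [h1, h2]
  rw [Finset.sum_comm]
  exact Finset.sum_congr rfl fun i _ => Finset.sum_congr rfl fun j _ => by
    rw [trace_mul_comm (f i)]

theorem contract_sum_kronecker {s : ℕ} (g : Fin s → Matrix (Fin k) (Fin k) ℂ)
    (X : Matrix (Fin k) (Fin k) ℂ) :
    contract (∑ i, g i ⊗ₖ g i) X = ∑ i, trace (g i * X) • g i := by
  simpa using contract_sum (fun _ => 1) g g X

theorem IsPosSchmidtDecomposition.eq_sum_kronecker {s : ℕ}
    {D : Matrix (Fin k × Fin k) (Fin k × Fin k) ℂ} {f : Fin s → Matrix (Fin k) (Fin k) ℂ}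
    (hf : IsPosSchmidtDecomposition D f) : D = ∑ i, f i ⊗ₖ f i := by
  simpa using hf.1.eq_sum

theorem IsPosSchmidtDecomposition.contract_self {s : ℕ}
    {D : Matrix (Fin k × Fin k) (Fin k × Fin k) ℂ} {f : Fin s → Matrix (Fin k) (Fin k) ℂ}
    (hf : IsPosSchmidtDecomposition D f) (i : Fin s) : contract D (f i) = f i := by
  rw [hf.eq_sum_kronecker, contract_sum_kronecker, Finset.sum_eq_single i]
  · rw [hf.1.orthonormal_left.trace_mul hf.1.isHermitian_left, if_pos rfl, one_smul]
  · intro j _ hj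
    rw [hf.1.orthonormal_left.trace_mul hf.1.isHermitian_left, if_neg hj, zero_smul]
  · simp

theorem IsPosSchmidtDecomposition.eq_combination {s t : ℕ}
    {D : Matrix (Fin k × Fin k) (Fin k × Fin k) ℂ} {f : Fin s → Matrix (Fin k) (Fin k) ℂ}
    {g : Fin t → Matrix (Fin k) (Fin k) ℂ}
    (hf : IsPosSchmidtDecomposition D f) (hg : D = ∑ i, g i ⊗ₖ g i) (i : Fin s) :
    f i = ∑ j, trace (g j * f i) • g j := by
  rw [← contract_sum_kronecker, ← hg, hf.contract_self]

/-- Nonnegativity of all pairings leaves no room for a nontrivial orthogonal change of basis: an `f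
i` that pairs nontrivially with `g j` is orthogonal to every other `g l`, hence equals `g j`. -/
theorem IsPosSchmidtDecomposition.unique {s : ℕ}
    {D : Matrix (Fin k × Fin k) (Fin k × Fin k) ℂ} {f g : Fin s → Matrix (Fin k) (Fin k) ℂ}
    (hf : IsPosSchmidtDecomposition D f) (hg : IsPosSchmidtDecomposition D g) :
    ∃ σ : Equiv.Perm (Fin s), ∀ i, g i = f (σ i) := by
  have hfo := hf.1.orthonormal_left
  have hgo := hg.1.orthonormal_left
  have hfh := hf.1.isHermitian_left
  have hgh := hg.1.isHermitian_left
  have hex : ∀ j, ∃ i, g j = f i := by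
    intro j
    have h1 : ∃ i, trace (f i * g j) ≠ 0 := by
      by_contra hcon
      push Not at hcon
      have h2 := hg.eq_combination hf.eq_sum_kronecker j
      simp only [hcon, zero_smul, Finset.sum_const_zero] at h2
      have h3 := hgo.trace_mul hgh j j
      rw [h2] at h3
      simp at h3
    obtain ⟨i, hi⟩ := h1
    have h4 : ∀ l, l ≠ j → trace (g l * f i) = 0 := by
      intro l hl
      have h5 : trace (g j * g l) = 0 := by rw [hgo.trace_mul hgh, if_neg hl.symm]
      rw [hg.eq_combination hf.eq_sum_kronecker l, trace_mul_sum] at h5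
      -- Expanding `tr (g j * g l) = 0` in the family `f` gives a sum of nonnegative terms, so each
      -- one vanishes.
      have h6 : ∀ i ∈ Finset.univ, (0 : ℂ) ≤ trace (f i * g l) * trace (g j * f i) :=
        fun i _ => mul_nonneg (trace_mul_nonneg (hf.2 i) (hg.2 l))
          (trace_mul_nonneg (hg.2 j) (hf.2 i))
      have h7 := (Finset.sum_eq_zero_iff_of_nonneg h6).mp h5 i (Finset.mem_univ i)
      rw [trace_mul_comm (g l)]
      refine (mul_eq_zero.mp h7).resolve_right ?_
      rwa [trace_mul_comm]
    have h8 := hf.eq_combination hg.eq_sum_kronecker i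
    rw [Finset.sum_eq_single j (fun l _ hl => by rw [h4 l hl, zero_smul]) (by simp)] at h8
    set c := trace (g j * f i) with hc
    have hc0 : 0 ≤ c := trace_mul_nonneg (hg.2 j) (hf.2 i)
    have h9 : c * c = 1 := by
      have h10 := hfo.trace_mul hfh i i
      rw [if_pos rfl, h8, smul_mul, Matrix.mul_smul, trace_smul, trace_smul,
        hgo.trace_mul hgh, if_pos rfl] at h10
      simpa using h10
    have h11 : c = 1 := by
      rcases mul_self_eq_one_iff.mp h9 with h | h
      · exact h
      · rw [h] at hc0
        have := (Complex.nonneg_iff.mp hc0).1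
        norm_num at this
    exact ⟨i, by rw [h8, h11, one_smul]⟩
  choose σ hσ using hex
  have hinj : Function.Injective σ := by
    intro a b hab
    by_contra hne
    have h1 := hgo.trace_mul hgh a b
    rw [if_neg hne, hσ a, hσ b, hab, hfo.trace_mul hfh, if_pos rfl] at h1
    exact one_ne_zero h1
  exact ⟨Equiv.ofBijective σ (Finite.injective_iff_bijective.mp hinj), hσ⟩

theorem exists_posSemidef_basis {s : ℕ} {A : Matrix (Fin k × Fin k) (Fin k × Fin k) ℂ} {L : ℝ}
    {lam : Fin n → ℝ} {γ : Fin n → Matrix (Fin k) (Fin k) ℂ}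
    (h : IsHermitianSchmidtDecomposition A lam γ γ) (hA : A.PosSemidef) (hL : 0 < L)
    (hlam : ∀ i, lam i ≤ L) {g : Fin s → Matrix (Fin k) (Fin k) ℂ} (hgo : TraceOrthonormal g)
    (hg : ∀ i, IsEigen A L (g i)) (hspan : ∀ X, IsEigen A L X → X = ∑ i, trace (g i * X) • g i) :
    ∃ f : Fin s → Matrix (Fin k) (Fin k) ℂ, IsPosSchmidtDecomposition (∑ i, g i ⊗ₖ g i) f := by
  classical
  have hgh := fun i => (hg i).herm
  let P : ℕ → Prop := fun t => ∃ f : Fin t → Matrix (Fin k) (Fin k) ℂ, IsPosEigenFamily A L f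
  have hP0 : P 0 := ⟨Fin.elim0, fun i => i.elim0, fun i => i.elim0, fun i => i.elim0⟩
  -- Double counting of squared coefficients: each `f i` contributes exactly one by `hspan`, and
  -- each `g j` receives at most one by Bessel.
  have hbound : ∀ t, P t → t ≤ s := by
    rintro t ⟨f, hf⟩
    have hfh := fun i => (hf.pos i).isHermitian
    have h1 : ∀ i, ∑ j, (trace (g j * f i)).re ^ 2 = 1 := fun i => by
      have h2 := hf.orthonormal.trace_mul hfh i i
      have h3 := congrArg (fun X => trace (f i * X)) (hspan _ (hf.isEigen i))
      simp only [trace_mul_sum] at h3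
      rw [h2, if_pos rfl] at h3
      have h4 := congrArg Complex.re h3
      rw [Complex.one_re, Complex.re_sum] at h4
      rw [h4]
      refine Finset.sum_congr rfl fun j _ => ?_
      rw [trace_mul_comm (f i), ← trace_mul_ofReal (hgh j) (hfh i)]
      norm_cast
      ring
    have h5 : ∀ j, ∑ i, (trace (g j * f i)).re ^ 2 ≤ 1 := fun j => by
      have h6 := hf.orthonormal.bessel hfh (hgh j)
      rw [hgo.trace_mul hgh, if_pos rfl] at h6
      simpa only [trace_mul_comm (g j), Complex.one_re] using h6
    have h7 : (t : ℝ) ≤ s := by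
      calc (t : ℝ) = ∑ i : Fin t, ∑ j, (trace (g j * f i)).re ^ 2 := by simp [h1]
        _ = ∑ j, ∑ i, (trace (g j * f i)).re ^ 2 := Finset.sum_comm
        _ ≤ ∑ j : Fin s, 1 := Finset.sum_le_sum fun j _ => h5 j
        _ = s := by simp
    exact_mod_cast h7
  obtain ⟨f, hf⟩ : P (Nat.findGreatest P s) := Nat.findGreatest_spec (Nat.zero_le s) hP0
  have hmax : ¬ P (Nat.findGreatest P s + 1) := fun hP =>
    absurd (Nat.le_findGreatest (hbound _ hP) hP) (by omega)
  generalize Nat.findGreatest P s = t at f hf hmax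
  have hfh := fun i => (hf.pos i).isHermitian
  have hall : ∀ X, IsEigen A L X → X = ∑ i, trace (f i * X) • f i := by
    intro X hX
    by_contra hne
    -- The residual of `X` is an eigenvector orthogonal to the family; if nonzero, it would
    -- contradict maximality.
    refine hmax (hf.exists_succ h hA hL hlam
      (hX.sub (IsEigen.combination hf.isEigen hX.herm)) (sub_ne_zero.mpr hne) fun i => ?_)
    rw [Matrix.mul_sub, trace_sub, hf.orthonormal.trace_mul_combination hfh, sub_self]
  have hfg := fun i => hspan _ (hf.isEigen i)
  have hgf := fun j => hall _ (hg j)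
  obtain rfl := card_eq_of_combination hf.orthonormal hgo hfh hgh hfg hgf
  refine ⟨f, ⟨⟨⟨fun _ => one_pos, hf.orthonormal, hf.orthonormal, ?_⟩, hfh, hfh⟩, hf.pos⟩⟩
  simpa using sum_kronecker_eq_of_combination hfg hgf

/-! ### Compressions of `A` and their SPC property. -/

/-- Diagonalising the Gram matrix turns `∑ i, ζ i ⊗ ζ i` into a Hermitian Schmidt decomposition. -/
theorem isSPC_of_eq_sum {B : Matrix (Fin k × Fin k) (Fin k × Fin k) ℂ} (hB : B.PosSemidef)
    {ζ : Fin n → Matrix (Fin k) (Fin k) ℂ} (hζ : ∀ i, (ζ i).IsHermitian)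
    (hsum : B = ∑ i, ζ i ⊗ₖ ζ i) : IsSPC B := by
  classical
  -- The Gram matrix of Hermitian matrices is real, so its diagonalising matrix `O` can be taken
  -- real orthogonal. Hence the `ξ a` stay Hermitian and the sum of `ζ l ⊗ ζ l` is preserved.
  let Q : Matrix (Fin n) (Fin n) ℝ := Matrix.of fun i j => (trace (ζ i * ζ j)).re
  have hQ : Q.IsHermitian := by
    ext i j
    simp [Q, trace_mul_comm (ζ j)]
  let O : Fin n → Fin n → ℝ := fun l a => (hQ.eigenvectorUnitary : Matrix (Fin n) (Fin n) ℝ) l a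
  let μ := hQ.eigenvalues
  have hO1 : ∀ l m, ∑ a, O l a * O m a = if l = m then 1 else 0 := fun l m => by
    have := congrFun (congrFun (Unitary.coe_mul_star_self hQ.eigenvectorUnitary) l) m
    simpa [O, mul_apply, star_apply, one_apply] using this
  have hO2 : ∀ a b, ∑ l, O l a * ∑ m, Q l m * O m b = if a = b then μ a else 0 := fun a b => by
    have h1 : (star (hQ.eigenvectorUnitary : Matrix (Fin n) (Fin n) ℝ) * Q *
        (hQ.eigenvectorUnitary : Matrix (Fin n) (Fin n) ℝ)) = diagonal μ := by
      have := hQ.conjStarAlgAut_star_eigenvectorUnitary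
      rw [Unitary.conjStarAlgAut_star_apply] at this
      simpa [Function.comp_def] using this
    have h2 := congrFun (congrFun h1 a) b
    rw [Matrix.mul_assoc, diagonal_apply] at h2
    rw [← h2]
    simp [mul_apply, star_apply, O]
  let ξ : Fin n → Matrix (Fin k) (Fin k) ℂ := fun a => ∑ l, (O l a : ℂ) • ζ l
  have hξ : ∀ a, (ξ a).IsHermitian := fun a => by
    simp only [IsHermitian, ξ, conjTranspose_sum]
    exact Finset.sum_congr rfl fun l _ => isHermitian_ofReal_smul (hζ l) _
  have htr : ∀ a b, trace (ξ a * ξ b) = if a = b then (μ a : ℂ) else 0 := fun a b => by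
    have h1 : trace (ξ a * ξ b) = ((∑ l, O l a * ∑ m, Q l m * O m b : ℝ) : ℂ) := by
      simp only [ξ, Matrix.sum_mul, smul_mul, trace_sum, trace_smul, trace_mul_sum, smul_eq_mul]
      push_cast
      refine Finset.sum_congr rfl fun l _ => ?_
      congr 1
      refine Finset.sum_congr rfl fun m _ => ?_
      simp only [Q, of_apply]
      rw [trace_mul_ofReal (hζ l) (hζ m), mul_comm]
    rw [h1, hO2]
    split_ifs <;> simp
  have hμ : ∀ a, 0 ≤ μ a := fun a => by
    have h1 := trace_mul_self_nonneg (hξ a)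
    rwa [htr, if_pos rfl, Complex.ofReal_re] at h1
  have hξ0 : ∀ a, μ a = 0 → ξ a = 0 := fun a ha =>
    eq_zero_of_trace_mul_self (hξ a) (by rw [htr, if_pos rfl, ha]; simp)
  have hB2 : B = ∑ a, ξ a ⊗ₖ ξ a := by
    have h1 : ∀ a, ξ a ⊗ₖ ξ a = ∑ l, ∑ m, ((O l a * O m a : ℝ) : ℂ) • (ζ l ⊗ₖ ζ m) := fun a => by
      simp only [ξ, sum_smul_kronecker, kronecker_sum_smul, Finset.smul_sum, smul_smul]
      rw [Finset.sum_comm]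
      exact Finset.sum_congr rfl fun l _ => Finset.sum_congr rfl fun m _ => by
        rw [mul_comm, Complex.ofReal_mul]
    simp only [h1]
    rw [Finset.sum_comm, hsum]
    refine Finset.sum_congr rfl fun l _ => ?_
    rw [Finset.sum_comm]
    simp only [← Finset.sum_smul, ← Complex.ofReal_sum, hO1]
    simp
  -- As `‖ξ a‖² = μ a`, indices with `μ a = 0` contribute nothing; the others are normalised and `μ
  -- a` becomes the coefficient.
  let T := {a // μ a ≠ 0}
  let e : Fin (Fintype.card T) ≃ T := (Fintype.equivFin T).symm
  have hpos : ∀ a : T, 0 < μ a := fun a => lt_of_le_of_ne (hμ a) a.2.symm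
  let η : Fin (Fintype.card T) → Matrix (Fin k) (Fin k) ℂ :=
    fun i => (((√(μ (e i)))⁻¹ : ℝ) : ℂ) • ξ (e i)
  have hη : ∀ i, (η i).IsHermitian := fun i => isHermitian_ofReal_smul (hξ _) _
  have hon : TraceOrthonormal η := fun i j => by
    rw [(hη j).eq]
    simp only [η, smul_mul, Matrix.mul_smul, trace_smul, htr, smul_eq_mul]
    rcases eq_or_ne i j with rfl | hij
    · rw [if_pos rfl, if_pos rfl]
      norm_cast
      have h2 := Real.sq_sqrt (hpos (e i)).le
      rw [← mul_assoc, ← mul_inv, ← sq, h2]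
      exact inv_mul_cancel₀ (hpos (e i)).ne'
    · rw [if_neg hij, if_neg fun h => hij (e.injective (Subtype.ext h))]
      simp
  refine ⟨hB, _, fun i => μ (e i), η, ⟨⟨fun i => hpos _, hon, hon, ?_⟩, hη, hη⟩⟩
  have h3 : ∀ i, ((μ (e i) : ℝ) : ℂ) • (η i ⊗ₖ η i) = ξ (e i) ⊗ₖ ξ (e i) := fun i => by
    simp only [η, smul_kronecker, kronecker_smul, smul_smul]
    norm_cast
    have h2 := Real.sq_sqrt (hpos (e i)).le
    rw [← mul_inv, ← sq, h2, mul_inv_cancel₀ (hpos (e i)).ne']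
    simp
  simp only [h3]
  rw [Equiv.sum_comp e (fun a : T => ξ a ⊗ₖ ξ a), hB2]
  rw [← Finset.sum_subtype (Finset.univ.filter fun a => μ a ≠ 0) (by simp) fun a => ξ a ⊗ₖ ξ a]
  refine (Finset.sum_filter_of_ne (p := fun a => μ a ≠ 0) fun a _ ha h0 => ha ?_).symm
  rw [hξ0 a h0, zero_kronecker]

/-- The matrices `V γ i V` need not remain orthonormal, so `√(lam i)` is absorbed into them and the
Gram argument restores a Schmidt decomposition. -/
theorem isSPC_compress {A : Matrix (Fin k × Fin k) (Fin k × Fin k) ℂ} {lam : Fin n → ℝ}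
    {γ : Fin n → Matrix (Fin k) (Fin k) ℂ} (h : IsHermitianSchmidtDecomposition A lam γ γ)
    (hA : A.PosSemidef) {V : Matrix (Fin k) (Fin k) ℂ} (hV : V.IsHermitian) :
    IsSPC ((V ⊗ₖ V) * A * (V ⊗ₖ V)) := by
  have hVV : (V ⊗ₖ V)ᴴ = V ⊗ₖ V := by rw [conjTranspose_kronecker, hV.eq]
  have hpos : ((V ⊗ₖ V) * A * (V ⊗ₖ V)).PosSemidef := by
    have := hA.mul_mul_conjTranspose_same (V ⊗ₖ V)
    rwa [hVV] at this
  refine isSPC_of_eq_sum hpos (ζ := fun i => ((√(lam i) : ℝ) : ℂ) • (V * γ i * V))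
    (fun i => isHermitian_ofReal_smul ?_ _) ?_
  · rw [IsHermitian, conjTranspose_mul, conjTranspose_mul, hV.eq, (h.isHermitian_left i).eq,
      Matrix.mul_assoc]
  · conv_lhs => rw [h.eq_sum]
    rw [Matrix.mul_sum, Matrix.sum_mul]
    refine Finset.sum_congr rfl fun i _ => ?_
    rw [Matrix.mul_smul, smul_mul, ← mul_kronecker_mul, ← mul_kronecker_mul, smul_kronecker,
      kronecker_smul, smul_smul, ← Complex.ofReal_mul, Real.mul_self_sqrt (h.pos i).le]

/-- If the projections `V i` resolve the identity, commute with the `γ l`, and the mixed terms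
`A (V i ⊗ V j)` vanish, then `A` is the sum of its compressions. -/
theorem eq_sum_compress {r : ℕ} {A : Matrix (Fin k × Fin k) (Fin k × Fin k) ℂ} {lam : Fin n → ℝ}
    {γ : Fin n → Matrix (Fin k) (Fin k) ℂ} (h : IsHermitianSchmidtDecomposition A lam γ γ)
    {V : Fin r → Matrix (Fin k) (Fin k) ℂ} (hone : ∑ i, V i = 1) (hidem : ∀ i, V i * V i = V i)
    (hcomm : ∀ i l, γ l * V i = V i * γ l)
    (hmix : ∀ i j, i ≠ j → A * (V i ⊗ₖ V j) = 0) :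
    A = ∑ i, (V i ⊗ₖ V i) * A * (V i ⊗ₖ V i) := by
  have h1 : (1 : Matrix (Fin k × Fin k) (Fin k × Fin k) ℂ) = ∑ i, ∑ j, V i ⊗ₖ V j := by
    rw [← one_kronecker_one, ← hone]
    have := sum_smul_kronecker (fun _ => 1) V (∑ i, V i)
    simp only [one_smul] at this
    rw [this]
    refine Finset.sum_congr rfl fun i _ => ?_
    simpa using kronecker_sum_smul (fun _ => 1) V (V i)
  have h2 : ∀ i, A * (V i ⊗ₖ V i) = (V i ⊗ₖ V i) * A * (V i ⊗ₖ V i) := fun i => by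
    have h3 : (V i ⊗ₖ V i) * A = A * (V i ⊗ₖ V i) := by
      rw [h.eq_sum, Matrix.mul_sum, Matrix.sum_mul]
      refine Finset.sum_congr rfl fun l _ => ?_
      rw [Matrix.mul_smul, smul_mul, ← mul_kronecker_mul, ← mul_kronecker_mul, hcomm]
    rw [h3, Matrix.mul_assoc, ← mul_kronecker_mul, hidem]
  conv_lhs => rw [← Matrix.mul_one A, h1]
  rw [Matrix.mul_sum]
  refine Finset.sum_congr rfl fun i _ => ?_
  rw [Matrix.mul_sum, ← h2, Finset.sum_eq_single i]
  · exact fun j _ hj => hmix i j hj.symm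
  · simp

theorem hermProj_mul_eq_zero {M N : Matrix (Fin k) (Fin k) ℂ} (hM : M.IsHermitian)
    (h : M * N = 0) : hermProj (image M) * hermProj (image N) = 0 := by
  obtain ⟨Z, hZ⟩ := exists_hermProj_image_eq N
  rw [hZ, ← Matrix.mul_assoc, hermProj_image_mul_eq_zero hM h, Matrix.zero_mul]

end SplitDecomposition

/-! ### The split decomposition. -/

open SplitDecomposition in
theorem mainTheorem3 (k n s : ℕ) (hs : 1 ≤ s) (hsn : s ≤ n)
    (A : Matrix (Fin k × Fin k) (Fin k × Fin k) ℂ) (hA : IsSPC A)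
    (lam : Fin n → ℝ) (γ : Fin n → Matrix (Fin k) (Fin k) ℂ)
    (hdec : IsHermitianSchmidtDecomposition A lam γ γ)
    (hanti : Antitone lam)
    (heq : ∀ i j : Fin n, (i : ℕ) < s → (j : ℕ) < s → lam i = lam j)
    (hgt : ∀ i j : Fin n, (i : ℕ) < s → s ≤ (j : ℕ) → lam j < lam i)
    (D : Matrix (Fin k × Fin k) (Fin k × Fin k) ℂ)
    (hD : D = ∑ i : Fin s, γ (Fin.castLE hsn i) ⊗ₖ γ (Fin.castLE hsn i)) :
    (∃ γ' : Fin s → Matrix (Fin k) (Fin k) ℂ, IsPosSchmidtDecomposition D γ' ∧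
      ∀ γ'' : Fin s → Matrix (Fin k) (Fin k) ℂ, IsPosSchmidtDecomposition D γ'' →
        ∃ σ : Equiv.Perm (Fin s), ∀ i, γ'' i = γ' (σ i)) ∧
    ∀ γ' : Fin s → Matrix (Fin k) (Fin k) ℂ, IsPosSchmidtDecomposition D γ' →
      iSupIndep (fun i => image (γ' i)) ∧
      A = ∑ i : Fin (s + 1),
        (splitProj γ' i ⊗ₖ splitProj γ' i) * A * (splitProj γ' i ⊗ₖ splitProj γ' i) ∧
      ∀ i : Fin (s + 1),
        IsSPC ((splitProj γ' i ⊗ₖ splitProj γ' i) * A * (splitProj γ' i ⊗ₖ splitProj γ' i)) := by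
  have hgh := hdec.isHermitian_left
  have hgo := hdec.orthonormal_left
  let i₀ : Fin n := ⟨0, by omega⟩
  obtain ⟨L, hLdef⟩ : ∃ L, L = lam i₀ := ⟨_, rfl⟩
  have hL : 0 < L := hLdef ▸ hdec.pos i₀
  have hlam : ∀ i, lam i ≤ L := fun i => hLdef ▸ hanti (Nat.zero_le _)
  let g : Fin s → Matrix (Fin k) (Fin k) ℂ := fun i => γ (Fin.castLE hsn i)
  have hg : ∀ i, IsEigen A L (g i) := fun i => by
    refine ⟨hgh _, ?_⟩
    rw [hdec.contract_eq, Finset.sum_eq_single (Fin.castLE hsn i)]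
    · rw [hgo.trace_mul hgh, if_pos rfl, mul_one, hLdef,
        heq (Fin.castLE hsn i) i₀ i.2 (by simp only [i₀]; omega)]
    · intro j _ hj
      rw [hgo.trace_mul hgh, if_neg hj]
      simp
    · simp
  have hgo' : TraceOrthonormal g := fun i j => by
    simp only [g, hgo _ _, Fin.castLE_inj]
  -- Pairing the eigenvalue equation with `γ j` gives `(lam j - L) * tr (γ j * X) = 0`; the strict
  -- gap removes all `j ≥ s`.
  have hspan : ∀ X, IsEigen A L X → X = ∑ i, Matrix.trace (g i * X) • g i := by
    intro X hX
    have hL' : (L : ℂ) ≠ 0 := by exact_mod_cast hL.ne'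
    have h1 : ∀ j, (lam j : ℂ) * Matrix.trace (γ j * X) = L * Matrix.trace (γ j * X) := fun j => by
      have h2 := congrArg (fun Y => Matrix.trace (γ j * Y)) hX.eq
      simp only [hdec.contract_eq, hgo.trace_mul_combination hgh, Matrix.mul_smul,
        Matrix.trace_smul, smul_eq_mul] at h2
      exact h2
    have h3 : X = ∑ j, Matrix.trace (γ j * X) • γ j := by
      refine smul_right_injective _ hL' ?_
      simp only
      rw [← hX.eq, hdec.contract_eq, Finset.smul_sum]
      exact Finset.sum_congr rfl fun j _ => by rw [h1, smul_smul]
    have h4 : ∀ j : Fin n, s ≤ (j : ℕ) → Matrix.trace (γ j * X) = 0 := fun j hj => by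
      have h5 := h1 j
      rw [← sub_eq_zero, ← sub_mul] at h5
      refine (mul_eq_zero.mp h5).resolve_left (sub_ne_zero.mpr ?_)
      have := hgt i₀ j (by simp only [i₀]; omega) hj
      exact_mod_cast (hLdef ▸ this).ne
    conv_lhs => rw [h3]
    symm
    refine Finset.sum_of_injOn (Fin.castLE hsn) (Fin.castLE_injective hsn).injOn (by simp) ?_
      fun i _ => rfl
    intro j _ hj
    rw [h4 j, zero_smul]
    by_contra hlt
    exact hj ⟨⟨j, not_le.mp hlt⟩, by simp, rfl⟩
  constructor
  · obtain ⟨f, hf⟩ := exists_posSemidef_basis hdec hA.1 hL hlam hgo' hg hspan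
    rw [← show D = ∑ i, g i ⊗ₖ g i from hD] at hf
    exact ⟨f, hf, fun f' hf' => hf.unique hf'⟩
  · intro f hf
    have hfE : ∀ i, IsEigen A L (f i) := fun i => by
      rw [hf.eq_combination (g := g) hD i]
      exact IsEigen.combination hg (hf.1.isHermitian_left i)
    have hVV : Pairwise fun i j => hermProj (image (f i)) * hermProj (image (f j)) = 0 :=
      fun i j hij => hermProj_mul_eq_zero (hf.1.isHermitian_left i)
        (hf.1.orthonormal_left.mul_eq_zero hf.2 hij)
    have hlast : splitProj f (Fin.last s) = 1 - ∑ i, hermProj (image (f i)) := by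
      rw [splitProj, Fin.snoc_last, hermProj_orthogonal, hermProj_iSup hVV]
    have hcast : ∀ i : Fin s, splitProj f i.castSucc = hermProj (image (f i)) := fun i => by
      rw [splitProj, Fin.snoc_castSucc]
    have hproj : ∀ i, ∃ U, splitProj f i = hermProj U :=
      Fin.lastCases ⟨_, by rw [splitProj, Fin.snoc_last]⟩ fun i => ⟨_, hcast i⟩
    have hherm : ∀ i, (splitProj f i).IsHermitian := fun i => by
      obtain ⟨U, hU⟩ := hproj i
      exact hU ▸ hermProj_isHermitian U
    have hone : ∑ i, splitProj f i = 1 := by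
      rw [Fin.sum_univ_castSucc, hlast]
      simp only [hcast]
      abel
    refine ⟨iSupIndep_of_hermProj_mul hVV, ?_, fun i => isSPC_compress hdec hA.1 (hherm i)⟩
    -- Each other projection lies below `1 - V i`, so a mixed block `V i ⊗ V j` factors through `V i
    -- ⊗ (1 - V i)` or its mirror image, both killed by `A`. At least one index of a mixed pair is
    -- not the last.
    have horth : ∀ (i : Fin s) (j : Fin (s + 1)), i.castSucc ≠ j →
        (1 - hermProj (image (f i))) * splitProj f j = splitProj f j := by
      intro i
      refine Fin.lastCases (fun _ => ?_) fun j hij => ?_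
      · have h1 : hermProj (image (f i)) * ∑ j, hermProj (image (f j)) =
            hermProj (image (f i)) := by
          rw [Matrix.mul_sum, Finset.sum_eq_single i (fun j _ hj => hVV hj.symm) (by simp),
            hermProj_mul_self]
        rw [hlast, Matrix.sub_mul, Matrix.one_mul, Matrix.mul_sub, Matrix.mul_one, h1, sub_self,
          sub_zero]
      · rw [hcast, Matrix.sub_mul, Matrix.one_mul, hVV fun h => hij (congrArg _ h), sub_zero]
    refine eq_sum_compress hdec hone (fun i => ?_) (fun i l => ?_) ?_
    · obtain ⟨U, hU⟩ := hproj i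
      rw [hU, hermProj_mul_self]
    · refine Fin.lastCases ?_ (fun i => ?_) i
      · rw [hlast, Matrix.mul_sub, Matrix.sub_mul, Matrix.mul_one, Matrix.one_mul, Matrix.mul_sum,
          Matrix.sum_mul]
        simp only [hdec.commute_hermProj hA.1 (hf.2 _) (hfE _)]
      · rw [hcast, hdec.commute_hermProj hA.1 (hf.2 _) (hfE _)]
    · intro i j hij
      induction i using Fin.lastCases with
      | cast i =>
        have h1 := mul_kronecker_eq_zero hA.1 (hf.2 i) (hfE i)
        rw [hcast, ← horth i j hij, ← Matrix.mul_one (hermProj (image (f i))),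
          Matrix.mul_kronecker_mul, ← Matrix.mul_assoc, Matrix.mul_one, h1, Matrix.zero_mul]
      | last =>
        induction j using Fin.lastCases with
        | cast j =>
          have h1 := hdec.mul_kronecker_eq_zero' hA.1 (hf.2 j) (hfE j)
          rw [hcast, ← horth j _ hij.symm, ← Matrix.mul_one (hermProj (image (f j))),
            Matrix.mul_kronecker_mul, ← Matrix.mul_assoc, Matrix.mul_one, h1, Matrix.zero_mul]
        | last => exact absurd rfl hij
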